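/- Let $\mathrm{Ter}^\infty(\lambda\tau)$ be the set of finite and infinite $\lambda\tau$-terms, modulo $\alpha$-equivalence, generated coinductively by $M ::= x \mid \lambda x.M \mid MM \mid \tau(M)$ (it contains all ordinary $\lambda$-terms). The clocked $\lambda$-calculus is the rewrite system on $\mathrm{Ter}^\infty(\lambda\tau)$ with the rules $$(\lambda x.M)N \to \tau(M[N/x]), \qquad \tau(M)N \to \tau(MN),$$ applied at arbitrary positions. The clocked Lévy Tree $\mathrm{LT}_\tau(M)$ of a term $M$ is its unique infinitary normal form with respect to infinitary (strongly convergent) rewriting in the clocked $\lambda$-calculus. Let $\twoheadrightarrow_\beta$ denote finite (zero or more steps) reduction with the $\beta$-rule $(\lambda x.M)N \to M[N/x]$, applied at arbitrary positions, and let $\twoheadrightarrow\!\!\!\!\rightarrow_\tau$ denote infinitary (strongly convergent) rewriting with the rule $\tau(M) \to M$, applied at arbitrary positions. A term $M$ is globally improved by a term $N$ if $\mathrm{LT}_\tau(M) \twoheadrightarrow\!\!\!\!\rightarrow_\tau \mathrm{LT}_\tau(N)$. Theorem (Clocks are accelerated under reduction). Let $M, N \in \mathrm{Ter}^\infty(\lambda\tau)$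 with $M \twoheadrightarrow_\beta N$. Then $\mathrm{LT}_\tau(M)$ and $\mathrm{LT}_\tau(N)$ exist, and the reduct $N$ improves $M$ globally, that is, $$\mathrm{LT}_\tau(M) \twoheadrightarrow\!\!\!\!\rightarrow_\tau \mathrm{LT}_\tau(N).$$ -/

import Mathlib

namespace ClockedLambda

/-! ## Finite and infinite terms of the clocked lambda calculus

Terms are taken modulo `α`-equivalence, in de Bruijn notation: a variable is a natural number,
and an index that exceeds the number of enclosing abstractions denotes a free variable. -/

/-- The term formers: variables, abstraction, application and the unary symbol `τ`. -/
inductive Symb : Type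
  | var (n : ℕ)
  | lam
  | app
  | tau

/-- Argument places; for an application, `false` is the function and `true` the argument. -/
abbrev Symb.Arity : Symb → Type
  | .var _ => Empty
  | .lam => Unit
  | .app => Bool
  | .tau => Unit

/-- The signature of the clocked lambda calculus. -/
abbrev Sig : PFunctor.{0, 0} := ⟨Symb, Symb.Arity⟩

/-- Finite and infinite terms, coinductively generated by `M ::= x | λx.M | M M | τ(M)`. -/
abbrev Term : Type := Sig.M

/-- One constructor applied to elements of `X`. -/
abbrev Layer (X : Type) : Type := Sig X

namespace Layer

variable {X : Type}

def var (n : ℕ) : Layer X := ⟨Symb.var n, fun i => nomatch i⟩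
def lam (x : X) : Layer X := ⟨Symb.lam, fun _ => x⟩
def app (x y : X) : Layer X := ⟨Symb.app, fun i => match i with | false => x | true => y⟩
def tau (x : X) : Layer X := ⟨Symb.tau, fun _ => x⟩

end Layer

namespace Term

def var (n : ℕ) : Term := PFunctor.M.mk (Layer.var n)
def lam (M : Term) : Term := PFunctor.M.mk (Layer.lam M)
def app (M N : Term) : Term := PFunctor.M.mk (Layer.app M N)
def tau (M : Term) : Term := PFunctor.M.mk (Layer.tau M)

/-! ### Renaming and substitution -/

/-- A renaming of the indices, adapted for use below one abstraction. -/
def upRen (ρ : ℕ → ℕ) : ℕ → ℕ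
  | 0 => 0
  | n + 1 => ρ n + 1

/-- Renaming of the (free) variables of a term, by corecursion. -/
def rename (ρ : ℕ → ℕ) (M : Term) : Term :=
  PFunctor.M.corec
    (fun p : (ℕ → ℕ) × Term =>
      match PFunctor.M.dest p.2 with
      | ⟨.var n, _⟩ => Layer.var (p.1 n)
      | ⟨.lam, f⟩ => Layer.lam (upRen p.1, f ())
      | ⟨.app, f⟩ => Layer.app (p.1, f false) (p.1, f true)
      | ⟨.tau, f⟩ => Layer.tau (p.1, f ()))
    (ρ, M)

/-- A substitution, adapted for use below one abstraction. -/
def upSubst (σ : ℕ → Term) : ℕ → Term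
  | 0 => var 0
  | n + 1 => rename Nat.succ (σ n)

/-- One step of the corecursion that defines substitution. A state `Sum.inl M` is a finished
term `M`; a state `Sum.inr (σ, M)` stands for the term `M` in which `σ` is still to be carried
out. -/
def substStep : Term ⊕ ((ℕ → Term) × Term) → Layer (Term ⊕ ((ℕ → Term) × Term))
  | .inl M => Sig.map Sum.inl (PFunctor.M.dest M)
  | .inr (σ, M) =>
    match PFunctor.M.dest M with
    | ⟨.var n, _⟩ => Sig.map Sum.inl (PFunctor.M.dest (σ n))
    | ⟨.lam, f⟩ => Layer.lam (.inr (upSubst σ, f ()))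
    | ⟨.app, f⟩ => Layer.app (.inr (σ, f false)) (.inr (σ, f true))
    | ⟨.tau, f⟩ => Layer.tau (.inr (σ, f ()))

/-- Simultaneous capture-avoiding substitution of `σ n` for the variable `n`. -/
def subst (σ : ℕ → Term) (M : Term) : Term :=
  PFunctor.M.corec substStep (.inr (σ, M))

/-- The substitution that replaces the variable `0` by `N` and lowers all others by one. -/
def single (N : Term) : ℕ → Term
  | 0 => N
  | n + 1 => var n

/-- `inst M N` is `M[N/x]`, where `x` is the variable bound in `lam M`. -/
def inst (M N : Term) : Term := subst (single N) M

end Term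

open Term

/-! ## Rewriting finite and infinite terms -/

/-- One step of rewriting with the root steps `R`: a root step at an arbitrary (finite) position
of the term. -/
inductive Step (R : Term → Term → Prop) : Term → Term → Prop
  | root {M N : Term} : R M N → Step R M N
  | lam {M N : Term} : Step R M N → Step R (lam M) (lam N)
  | appL {M N : Term} (P : Term) : Step R M N → Step R (app M P) (app N P)
  | appR {M N : Term} (P : Term) : Step R M N → Step R (app P M) (app P N)
  | tau {M N : Term} : Step R M N → Step R (tau M) (tau N)

/-- Finite rewriting: zero or more steps. -/
def Red (R : Term → Term → Prop) : Term → Term → Prop := Relation.ReflTransGen (Step R)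

/-- `Below X M N`: the terms `M` and `N` have the same root symbol, and their immediate subterms
are related by `X`. -/
inductive Below (X : Term → Term → Prop) : Term → Term → Prop
  | var (n : ℕ) : Below X (var n) (var n)
  | lam {M N : Term} : X M N → Below X (lam M) (lam N)
  | app {M M' N N' : Term} : X M M' → X N N' → Below X (app M N) (app M' N')
  | tau {M N : Term} : X M N → Below X (tau M) (tau N)

/-- Infinitary (strongly convergent) rewriting, in its coinductive form: it is the greatest
relation `X` such that `X M N` implies that `M` rewrites in finitely many steps to a term that
has the same root symbol as `N` and whose immediate subterms are related by `X` to those of `N`. -/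
def InfRed (R : Term → Term → Prop) (M N : Term) : Prop :=
  ∃ X : Term → Term → Prop,
    (∀ P Q, X P Q → ∃ P', Red R P P' ∧ Below X P' Q) ∧ X M N

/-- A normal form: no step is possible at any position. -/
def IsNormalForm (R : Term → Term → Prop) (M : Term) : Prop := ∀ N, ¬ Step R M N

/-! ## The rewrite rules -/

/-- The `β`-rule `(λx.M) N → M[N/x]` of the classical lambda calculus. -/
inductive Beta : Term → Term → Prop
  | beta (M N : Term) : Beta (app (lam M) N) (inst M N)

/-- The two rules `(λx.M) N → τ(M[N/x])` and `τ(M) N → τ(M N)` of the clocked lambda calculus. -/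
inductive Clock : Term → Term → Prop
  | beta (M N : Term) : Clock (app (lam M) N) (tau (inst M N))
  | shift (M N : Term) : Clock (app (tau M) N) (tau (app M N))

/-- The rule `τ(M) → M` that deletes a `τ`. -/
inductive Delete : Term → Term → Prop
  | delete (M : Term) : Delete (tau M) M

/-! ## Clocked Lévy Trees -/

/-- `T` is an infinitary normal form of `M` in the clocked lambda calculus. -/
def HasInfNormalForm (M T : Term) : Prop := InfRed Clock M T ∧ IsNormalForm Clock T

/-- `T` is the clocked Lévy Tree of `M`: the unique infinitary normal form of `M` in the clocked
lambda calculus. -/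
def IsClockedLevyTree (M T : Term) : Prop :=
  HasInfNormalForm M T ∧ ∀ T', HasInfNormalForm M T' → T' = T

/-- `M` is globally improved by `N`: both have a clocked Lévy Tree, and that of `M` rewrites
infinitarily to that of `N` by deletion of `τ`'s. -/
def GloballyImprovedBy (M N : Term) : Prop :=
  ∃ S T, IsClockedLevyTree M S ∧ IsClockedLevyTree N T ∧ InfRed Delete S T

end ClockedLambda

/-!
Reduction in the clocked calculus is analysed through the deterministic relation `Emit M M'`, by
which `M` produces a `τ` at its root and continues as `M'`. Emitting whenever possible and copying
the root symbol otherwise defines, corecursively, a normal form `nf M` of every term `M`.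

Terms are compared by the coinductive relation `Sim K n M N`: the term `M` becomes `N` by emissions
at arbitrary positions, where, if `K` holds, emitted `τ`s may be dropped, finitely many on each left
spine. It contains a single step of the clocked calculus (`Sim.of_step_clock`, with no `τ` dropped)
and a single `β`-step (`Sim.of_step_beta`, where a `β`-step is an emission whose `τ` is dropped).
Since `Emit` and `Sim` are closed under substitution (`Emit.subst`, `Sim.subst`), emissions on the
two sides can be matched (`Sim.exists_emit`). If nothing is left to be emitted on the right, then
the bound `n` makes the left side stop as well (`Sim.emit_of_not_emits`). Hence `Sim` passes to
normal forms (`Sim.exists_skip_below_nf`).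

* With no `τ` dropped, this says that a step of the clocked calculus does not change `nf`
  (`nf_eq_of_red`). A normal form that is reached in the limit is then traced by coinduction to be
  `nf M`; the point to check is that an application in the limit comes from one that emits nothing,
  which holds because having a left spine that ends in an abstraction or a `τ` is preserved in the
  limit (`InfRed.active`). So `nf M` is the clocked Lévy Tree of `M` (`isClockedLevyTree_nf`).
* With dropped `τ`s, it says that a `β`-step `M → N` gives an infinitary deletion of `τ`s from
  `nf M` to `nf N` (`Sim.infRed_nf`). Several steps are composed by transitivity of infinitary
  deletion (`InfRed.trans_delete`).
-/

namespace ClockedLambda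
open Term

/-! ### Constructors and bisimulation -/

namespace Term

@[simp] theorem dest_var (n : ℕ) : PFunctor.M.dest (var n) = Layer.var n := PFunctor.M.dest_mk _
@[simp] theorem dest_lam (M : Term) : PFunctor.M.dest (lam M) = Layer.lam M := PFunctor.M.dest_mk _
@[simp] theorem dest_app (M N : Term) : PFunctor.M.dest (app M N) = Layer.app M N :=
  PFunctor.M.dest_mk _
@[simp] theorem dest_tau (M : Term) : PFunctor.M.dest (tau M) = Layer.tau M := PFunctor.M.dest_mk _

theorem exists_constructor (M : Term) :
    (∃ n, M = var n) ∨ (∃ A, M = lam A) ∨ (∃ A B, M = app A B) ∨ ∃ A, M = tau A := by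
  rw [← PFunctor.M.mk_dest M]
  obtain ⟨s, f⟩ := PFunctor.M.dest M
  cases s with
  | var n => exact .inl ⟨n, congrArg _ (Sigma.ext rfl (heq_of_eq (funext fun i => nomatch i)))⟩
  | lam => exact .inr (.inl ⟨f (), rfl⟩)
  | app =>
    refine .inr (.inr (.inl ⟨f false, f true, congrArg _ (Sigma.ext rfl (heq_of_eq ?_))⟩))
    funext i
    cases i <;> rfl
  | tau => exact .inr (.inr (.inr ⟨f (), rfl⟩))

@[elab_as_elim]
theorem casesOn {P : Term → Prop} (M : Term) (hvar : ∀ n, P (var n)) (hlam : ∀ A, P (lam A))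
    (happ : ∀ A B, P (app A B)) (htau : ∀ A, P (tau A)) : P M := by
  obtain ⟨n, rfl⟩ | ⟨A, rfl⟩ | ⟨A, B, rfl⟩ | ⟨A, rfl⟩ := exists_constructor M
  exacts [hvar n, hlam A, happ A B, htau A]

/-- The symbol at the root of a term. -/
def rootSymb (M : Term) : Symb := (PFunctor.M.dest M).1

@[simp] theorem rootSymb_var (n : ℕ) : rootSymb (var n) = .var n := rfl
@[simp] theorem rootSymb_lam (M : Term) : rootSymb (lam M) = .lam := rfl
@[simp] theorem rootSymb_app (M N : Term) : rootSymb (app M N) = .app := rfl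
@[simp] theorem rootSymb_tau (M : Term) : rootSymb (tau M) = .tau := rfl

theorem ne_of_rootSymb_ne {M N : Term} (h : rootSymb M ≠ rootSymb N) : M ≠ N :=
  fun e => h (congrArg rootSymb e)

@[simp] theorem var_ne_lam (n M) : var n ≠ lam M := ne_of_rootSymb_ne (by simp)
@[simp] theorem var_ne_app (n M N) : var n ≠ app M N := ne_of_rootSymb_ne (by simp)
@[simp] theorem var_ne_tau (n M) : var n ≠ tau M := ne_of_rootSymb_ne (by simp)
@[simp] theorem lam_ne_var (n M) : lam M ≠ var n := ne_of_rootSymb_ne (by simp)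
@[simp] theorem lam_ne_app (M A B) : lam M ≠ app A B := ne_of_rootSymb_ne (by simp)
@[simp] theorem lam_ne_tau (M A) : lam M ≠ tau A := ne_of_rootSymb_ne (by simp)
@[simp] theorem app_ne_var (n A B) : app A B ≠ var n := ne_of_rootSymb_ne (by simp)
@[simp] theorem app_ne_lam (M A B) : app A B ≠ lam M := ne_of_rootSymb_ne (by simp)
@[simp] theorem app_ne_tau (M A B) : app A B ≠ tau M := ne_of_rootSymb_ne (by simp)
@[simp] theorem tau_ne_var (n M) : tau M ≠ var n := ne_of_rootSymb_ne (by simp)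
@[simp] theorem tau_ne_lam (M A) : tau M ≠ lam A := ne_of_rootSymb_ne (by simp)
@[simp] theorem tau_ne_app (M A B) : tau M ≠ app A B := ne_of_rootSymb_ne (by simp)

@[simp] theorem var_inj {m n : ℕ} : var m = var n ↔ m = n :=
  ⟨fun h => by simpa using congrArg rootSymb h, fun h => h ▸ rfl⟩

@[simp] theorem lam_inj {M N : Term} : lam M = lam N ↔ M = N := by
  refine ⟨fun h => ?_, fun h => h ▸ rfl⟩
  have h := PFunctor.M.mk_inj h
  exact congrFun (eq_of_heq (Sigma.mk.inj h).2) ()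

@[simp] theorem tau_inj {M N : Term} : tau M = tau N ↔ M = N := by
  refine ⟨fun h => ?_, fun h => h ▸ rfl⟩
  have h := PFunctor.M.mk_inj h
  exact congrFun (eq_of_heq (Sigma.mk.inj h).2) ()

@[simp] theorem app_inj {M N A B : Term} : app M N = app A B ↔ M = A ∧ N = B := by
  refine ⟨fun h => ?_, fun h => h.1 ▸ h.2 ▸ rfl⟩
  have h := eq_of_heq (Sigma.mk.inj (PFunctor.M.mk_inj h)).2
  exact ⟨congrFun h false, congrFun h true⟩

end Term

theorem Below.mono {X Y : Term → Term → Prop} (h : ∀ P Q, X P Q → Y P Q) {M N : Term}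
    (b : Below X M N) : Below Y M N := by
  cases b with
  | var n => exact .var n
  | lam a => exact .lam (h _ _ a)
  | app a b => exact .app (h _ _ a) (h _ _ b)
  | tau a => exact .tau (h _ _ a)

theorem Below.refl {X : Term → Term → Prop} (h : ∀ P, X P P) (M : Term) : Below X M M := by
  cases M using Term.casesOn with
  | hvar n => exact .var n
  | hlam A => exact .lam (h A)
  | happ A B => exact .app (h A) (h B)
  | htau A => exact .tau (h A)

/-- Coinduction for equality of terms: a relation whose pairs agree at the root and are again
related at the immediate subterms consists of equal pairs. -/
theorem eq_of_below {X : Term → Term → Prop} (h : ∀ P Q, X P Q → Below X P Q) {M N : Term}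
    (hMN : X M N) : M = N := by
  refine PFunctor.M.bisim X (fun P Q hPQ => ?_) M N hMN
  cases h P Q hPQ with
  | var n => exact ⟨.var n, _, _, dest_var n, dest_var n, fun i => nomatch i⟩
  | lam a => exact ⟨.lam, _, _, dest_lam _, dest_lam _, fun _ => a⟩
  | app a b =>
    refine ⟨.app, _, _, dest_app _ _, dest_app _ _, fun i => ?_⟩
    cases i
    exacts [a, b]
  | tau a => exact ⟨.tau, _, _, dest_tau _, dest_tau _, fun _ => a⟩

/-- Coinduction for equality up to equality: pairs of equal terms need no further analysis. -/
theorem eq_of_eq_or_below {X : Term → Term → Prop}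
    (h : ∀ P Q, X P Q → P = Q ∨ Below X P Q) {M N : Term} (hMN : X M N) : M = N := by
  refine eq_of_below (X := fun P Q => P = Q ∨ X P Q) (fun P Q hPQ => ?_) (.inr hMN)
  obtain rfl | hPQ := hPQ
  · exact Below.refl (fun P => .inl rfl) P
  · obtain rfl | b := h P Q hPQ
    · exact Below.refl (fun P => .inl rfl) P
    · exact b.mono fun _ _ => .inr

/-! ### Substitution -/

namespace Term

theorem eq_of_dest_eq {M N : Term} (h : PFunctor.M.dest M = PFunctor.M.dest N) : M = N := by
  rw [← PFunctor.M.mk_dest M, h, PFunctor.M.mk_dest]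

theorem map_layer_var {X Y : Type} (f : X → Y) (n : ℕ) :
    Sig.map f (Layer.var n) = Layer.var n :=
  Sigma.ext rfl (heq_of_eq (funext fun i => nomatch i))

theorem map_layer_app {X Y : Type} (f : X → Y) (x y : X) :
    Sig.map f (Layer.app x y) = Layer.app (f x) (f y) := by
  refine Sigma.ext rfl (heq_of_eq (funext fun i => ?_))
  cases i <;> rfl

@[simp] theorem rename_var (ρ : ℕ → ℕ) (n : ℕ) : rename ρ (var n) = var (ρ n) := by
  apply eq_of_dest_eq
  rw [rename, PFunctor.M.dest_corec, dest_var]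
  exact map_layer_var _ _

@[simp] theorem rename_lam (ρ : ℕ → ℕ) (M : Term) :
    rename ρ (lam M) = lam (rename (upRen ρ) M) := by
  apply eq_of_dest_eq
  rw [rename, PFunctor.M.dest_corec, dest_lam]
  rfl

@[simp] theorem rename_app (ρ : ℕ → ℕ) (M N : Term) :
    rename ρ (app M N) = app (rename ρ M) (rename ρ N) := by
  apply eq_of_dest_eq
  rw [rename, PFunctor.M.dest_corec, dest_app]
  exact map_layer_app _ _ _

@[simp] theorem rename_tau (ρ : ℕ → ℕ) (M : Term) : rename ρ (tau M) = tau (rename ρ M) := by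
  apply eq_of_dest_eq
  rw [rename, PFunctor.M.dest_corec, dest_tau]
  rfl

theorem corec_substStep_inl (M : Term) : PFunctor.M.corec substStep (.inl M) = M := by
  refine PFunctor.M.bisim (fun P Q => P = PFunctor.M.corec substStep (.inl Q)) (fun P Q h => ?_)
    _ _ rfl
  subst h
  refine ⟨(PFunctor.M.dest Q).1, _, _, ?_, rfl, fun i => rfl⟩
  rw [PFunctor.M.dest_corec]
  rfl

@[simp] theorem subst_var (σ : ℕ → Term) (n : ℕ) : subst σ (var n) = σ n := by
  apply eq_of_dest_eq
  rw [subst, PFunctor.M.dest_corec, substStep, dest_var]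
  change Sig.map _ (Sig.map _ _) = _
  rw [PFunctor.map_map]
  conv_rhs => rw [← PFunctor.id_map (P := Sig) (PFunctor.M.dest (σ n))]
  congr 1
  exact funext corec_substStep_inl

@[simp] theorem subst_lam (σ : ℕ → Term) (M : Term) :
    subst σ (lam M) = lam (subst (upSubst σ) M) := by
  apply eq_of_dest_eq
  rw [subst, PFunctor.M.dest_corec, substStep, dest_lam]
  rfl

@[simp] theorem subst_app (σ : ℕ → Term) (M N : Term) :
    subst σ (app M N) = app (subst σ M) (subst σ N) := by
  apply eq_of_dest_eq
  rw [subst, PFunctor.M.dest_corec, substStep, dest_app]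
  exact map_layer_app _ _ _

@[simp] theorem subst_tau (σ : ℕ → Term) (M : Term) : subst σ (tau M) = tau (subst σ M) := by
  apply eq_of_dest_eq
  rw [subst, PFunctor.M.dest_corec, substStep, dest_tau]
  rfl

theorem upSubst_var_comp (ρ : ℕ → ℕ) :
    upSubst (fun i => var (ρ i)) = fun i => var (upRen ρ i) := by
  funext i
  cases i <;> simp [upSubst, upRen]

theorem rename_eq_subst (ρ : ℕ → ℕ) (M : Term) : rename ρ M = subst (fun i => var (ρ i)) M := by
  refine eq_of_below (X := fun P Q => ∃ ρ M, P = rename ρ M ∧ Q = subst (fun i => var (ρ i)) M)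
    ?_ ⟨ρ, M, rfl, rfl⟩
  rintro _ _ ⟨ρ, M, rfl, rfl⟩
  cases M using Term.casesOn with
  | hvar n => simpa using Below.var _
  | hlam A =>
    rw [rename_lam, subst_lam, upSubst_var_comp]
    exact .lam ⟨_, _, rfl, rfl⟩
  | happ A B => simpa using Below.app ⟨ρ, A, rfl, rfl⟩ ⟨ρ, B, rfl, rfl⟩
  | htau A => simpa using Below.tau ⟨ρ, A, rfl, rfl⟩

theorem subst_rename (σ : ℕ → Term) (ρ : ℕ → ℕ) (M : Term) :
    subst σ (rename ρ M) = subst (fun i => σ (ρ i)) M := by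
  refine eq_of_eq_or_below
    (X := fun P Q => ∃ σ ρ M, P = subst σ (rename ρ M) ∧ Q = subst (fun i => σ (ρ i)) M)
    ?_ ⟨σ, ρ, M, rfl, rfl⟩
  rintro _ _ ⟨σ, ρ, M, rfl, rfl⟩
  cases M using Term.casesOn with
  | hvar n => simp
  | hlam A =>
    refine .inr ?_
    have h : upSubst (fun i => σ (ρ i)) = fun i => upSubst σ (upRen ρ i) := by
      funext i
      cases i <;> rfl
    rw [rename_lam, subst_lam, subst_lam, h]
    exact .lam ⟨_, _, _, rfl, rfl⟩
  | happ A B => exact .inr (by simpa using Below.app ⟨σ, ρ, A, rfl, rfl⟩ ⟨σ, ρ, B, rfl, rfl⟩)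
  | htau A => exact .inr (by simpa using Below.tau ⟨σ, ρ, A, rfl, rfl⟩)

theorem rename_rename (ρ ρ' : ℕ → ℕ) (M : Term) :
    rename ρ (rename ρ' M) = rename (fun i => ρ (ρ' i)) M := by
  rw [rename_eq_subst, subst_rename, rename_eq_subst]

theorem rename_subst (ρ : ℕ → ℕ) (σ : ℕ → Term) (M : Term) :
    rename ρ (subst σ M) = subst (fun i => rename ρ (σ i)) M := by
  refine eq_of_eq_or_below
    (X := fun P Q => ∃ ρ σ M, P = rename ρ (subst σ M) ∧ Q = subst (fun i => rename ρ (σ i)) M)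
    ?_ ⟨ρ, σ, M, rfl, rfl⟩
  rintro _ _ ⟨ρ, σ, M, rfl, rfl⟩
  cases M using Term.casesOn with
  | hvar n => simp
  | hlam A =>
    refine .inr ?_
    have h : upSubst (fun i => rename ρ (σ i)) = fun i => rename (upRen ρ) (upSubst σ i) := by
      funext i
      cases i with
      | zero => simp [upSubst, upRen]
      | succ i => simp [upSubst, rename_rename, upRen]
    rw [subst_lam, rename_lam, subst_lam, h]
    exact .lam ⟨_, _, _, rfl, rfl⟩
  | happ A B => exact .inr (by simpa using Below.app ⟨ρ, σ, A, rfl, rfl⟩ ⟨ρ, σ, B, rfl, rfl⟩)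
  | htau A => exact .inr (by simpa using Below.tau ⟨ρ, σ, A, rfl, rfl⟩)

theorem subst_subst (σ θ : ℕ → Term) (M : Term) :
    subst σ (subst θ M) = subst (fun i => subst σ (θ i)) M := by
  refine eq_of_eq_or_below
    (X := fun P Q => ∃ σ θ M, P = subst σ (subst θ M) ∧ Q = subst (fun i => subst σ (θ i)) M)
    ?_ ⟨σ, θ, M, rfl, rfl⟩
  rintro _ _ ⟨σ, θ, M, rfl, rfl⟩
  cases M using Term.casesOn with
  | hvar n => simp
  | hlam A =>
    refine .inr ?_
    have h : upSubst (fun i => subst σ (θ i)) = fun i => subst (upSubst σ) (upSubst θ i) := by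
      funext i
      cases i with
      | zero => simp [upSubst]
      | succ i => simp [upSubst, subst_rename, rename_subst]
    rw [subst_lam, subst_lam, subst_lam, h]
    exact .lam ⟨_, _, _, rfl, rfl⟩
  | happ A B => exact .inr (by simpa using Below.app ⟨σ, θ, A, rfl, rfl⟩ ⟨σ, θ, B, rfl, rfl⟩)
  | htau A => exact .inr (by simpa using Below.tau ⟨σ, θ, A, rfl, rfl⟩)

theorem subst_var_eq_self (M : Term) : subst var M = M := by
  refine eq_of_below (X := fun P Q => P = subst var Q) ?_ rfl
  rintro _ M rfl
  cases M using Term.casesOn with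
  | hvar n => simpa using Below.var n
  | hlam A =>
    have h : upSubst var = var := by
      funext i
      cases i <;> simp [upSubst]
    rw [subst_lam, h]
    exact .lam rfl
  | happ A B =>
    rw [subst_app]
    exact .app rfl rfl
  | htau A =>
    rw [subst_tau]
    exact .tau rfl

theorem subst_inst (σ : ℕ → Term) (M N : Term) :
    subst σ (inst M N) = inst (subst (upSubst σ) M) (subst σ N) := by
  rw [inst, inst, subst_subst, subst_subst]
  congr 1
  funext i
  cases i with
  | zero => simp [single, upSubst]
  | succ i => simpa [single, upSubst, subst_rename] using (subst_var_eq_self (σ i)).symm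

end Term

/-! ### Emission of a `τ` at the root -/

/-- `Emit M M'`: the term `M` has a `τ` at its root or produces one by contracting the redex on its
left spine and moving the `τ` up, and `M'` is what remains below it, so `M` rewrites to `tau M'` in the clocked calculus. Forgetting the `τ`s that are
produced, this is weak head reduction in which deleting a `τ` on the left spine counts as a
step. -/
inductive Emit : Term → Term → Prop
  | tau (M : Term) : Emit (tau M) M
  | beta (M N : Term) : Emit (app (lam M) N) (inst M N)
  | app {M M' : Term} (N : Term) : Emit M M' → Emit (app M N) (app M' N)

/-- The term `M` produces a `τ` at its root. -/
def Emits (M : Term) : Prop := ∃ M', Emit M M'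

@[simp] theorem emit_tau_iff {M N : Term} : Emit (tau M) N ↔ N = M := by
  constructor
  · intro h
    generalize e : Term.tau M = P at h
    cases h <;> simp_all
  · rintro rfl
    exact .tau _

@[simp] theorem not_emit_var {n : ℕ} {N : Term} : ¬ Emit (var n) N := by
  intro h
  generalize e : Term.var n = P at h
  cases h <;> simp_all

@[simp] theorem not_emit_lam {M N : Term} : ¬ Emit (lam M) N := by
  intro h
  generalize e : Term.lam M = P at h
  cases h <;> simp_all

theorem emit_app_iff {M N P : Term} :
    Emit (app M N) P ↔
      (∃ A, M = lam A ∧ P = inst A N) ∨ ∃ M', Emit M M' ∧ P = app M' N := by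
  constructor
  · intro h
    generalize e : Term.app M N = Q at h
    cases h with
    | tau => simp at e
    | beta A B =>
      obtain ⟨rfl, rfl⟩ := app_inj.1 e
      exact .inl ⟨A, rfl, rfl⟩
    | app B h =>
      obtain ⟨rfl, rfl⟩ := app_inj.1 e
      exact .inr ⟨_, h, rfl⟩
  · rintro (⟨A, rfl, rfl⟩ | ⟨M', h, rfl⟩)
    exacts [.beta _ _, .app _ h]

theorem emits_tau (M : Term) : Emits (tau M) := ⟨M, .tau M⟩

theorem Emit.unique {M P Q : Term} (h : Emit M P) : Emit M Q → P = Q := by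
  induction h generalizing Q with
  | tau M => exact fun h => (emit_tau_iff.1 h).symm
  | beta M N =>
    intro h
    obtain ⟨A, e, rfl⟩ | ⟨M', h, -⟩ := emit_app_iff.1 h
    · rw [lam_inj.1 e]
    · exact absurd h not_emit_lam
  | app N h ih =>
    intro h'
    obtain ⟨A, rfl, rfl⟩ | ⟨M', e, rfl⟩ := emit_app_iff.1 h'
    · exact absurd h not_emit_lam
    · rw [ih e]

theorem Emit.subst {M M' : Term} (σ : ℕ → Term) (h : Emit M M') :
    Emit (subst σ M) (subst σ M') := by
  induction h with
  | tau M =>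
    rw [subst_tau]
    exact .tau _
  | beta M N =>
    rw [subst_app, subst_lam, subst_inst]
    exact .beta _ _
  | app N _ ih =>
    rw [subst_app, subst_app]
    exact .app _ ih

theorem Emit.rename {M M' : Term} (ρ : ℕ → ℕ) (h : Emit M M') :
    Emit (rename ρ M) (rename ρ M') := by
  rw [rename_eq_subst, rename_eq_subst]
  exact h.subst _

/-! ### Existence of infinitary normal forms -/

open Classical in
/-- One step of the corecursion that defines `nf`: a `τ` that can be produced is produced, and the
root symbol is copied otherwise. -/
noncomputable def nfStep (M : Term) : Layer Term :=
  if h : Emits M then Layer.tau h.choose else PFunctor.M.dest M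

/-- The infinitary normal form of a term with respect to the clocked calculus. -/
noncomputable def nf (M : Term) : Term := PFunctor.M.corec nfStep M

theorem nf_of_emit {M M' : Term} (h : Emit M M') : nf M = tau (nf M') := by
  have hM : Emits M := ⟨M', h⟩
  apply eq_of_dest_eq
  rw [nf, PFunctor.M.dest_corec, dest_tau, nfStep, dif_pos hM, h.unique hM.choose_spec]
  rfl

theorem dest_nf_of_not_emits {M : Term} (h : ¬ Emits M) :
    PFunctor.M.dest (nf M) = Sig.map nf (PFunctor.M.dest M) := by
  rw [nf, PFunctor.M.dest_corec, nfStep, dif_neg h]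
  rfl

theorem nf_var (n : ℕ) : nf (var n) = var n := by
  apply eq_of_dest_eq
  rw [dest_nf_of_not_emits (by simp [Emits]), dest_var]
  exact map_layer_var _ _

theorem nf_lam (M : Term) : nf (lam M) = lam (nf M) := by
  apply eq_of_dest_eq
  rw [dest_nf_of_not_emits (by simp [Emits]), dest_lam, dest_lam]
  rfl

theorem nf_app {M N : Term} (h : ¬ Emits (app M N)) : nf (app M N) = app (nf M) (nf N) := by
  apply eq_of_dest_eq
  rw [dest_nf_of_not_emits h, dest_app, dest_app]
  exact map_layer_app _ _ _

theorem Red.map {R : Term → Term → Prop} {f : Term → Term}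
    (hf : ∀ {P Q}, Step R P Q → Step R (f P) (f Q)) {M N : Term} (h : Red R M N) :
    Red R (f M) (f N) :=
  Relation.ReflTransGen.lift (p := Step R) f (fun _ _ => hf) _ _ h

theorem Emit.red {M M' : Term} (h : Emit M M') : Red Clock M (Term.tau M') := by
  induction h with
  | tau M => exact .refl
  | beta M N => exact .single (.root (.beta M N))
  | app N _ ih => exact .tail (ih.map (.appL N)) (.root (.shift _ _))

theorem infRed_nf (M : Term) : InfRed Clock M (nf M) := by
  refine ⟨fun P Q => Q = nf P, ?_, rfl⟩
  rintro M _ rfl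
  by_cases h : Emits M
  · obtain ⟨M', h⟩ := h
    exact ⟨_, h.red, nf_of_emit h ▸ .tau rfl⟩
  · refine ⟨M, .refl, ?_⟩
    cases M using Term.casesOn with
    | hvar n =>
      rw [nf_var]
      exact .var n
    | hlam A => exact nf_lam A ▸ .lam rfl
    | happ A B => exact nf_app h ▸ .app rfl rfl
    | htau A => exact absurd (emits_tau A) h

theorem eq_lam_of_nf_eq_lam {M A : Term} (h : nf M = lam A) : ∃ B, M = lam B := by
  by_cases hM : Emits M
  · obtain ⟨M', hM⟩ := hM
    simp [nf_of_emit hM] at h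
  · cases M using Term.casesOn with
    | hvar n => simp [nf_var] at h
    | hlam A => exact ⟨A, rfl⟩
    | happ A B => simp [nf_app hM] at h
    | htau A => exact absurd (emits_tau A) hM

theorem emits_of_nf_eq_tau {M A : Term} (h : nf M = tau A) : Emits M := by
  by_contra hM
  cases M using Term.casesOn with
  | hvar n => simp [nf_var] at h
  | hlam A => simp [nf_lam] at h
  | happ A B => simp [nf_app hM] at h
  | htau A => exact hM (emits_tau A)

theorem exists_app_of_nf_eq_app {M A B : Term} (h : nf M = app A B) :
    ∃ P Q, M = app P Q ∧ ¬ Emits M ∧ A = nf P ∧ B = nf Q := by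
  by_cases hM : Emits M
  · obtain ⟨M', hM⟩ := hM
    simp [nf_of_emit hM] at h
  · cases M using Term.casesOn with
    | hvar n => simp [nf_var] at h
    | hlam A => simp [nf_lam] at h
    | happ P Q =>
      rw [nf_app hM, app_inj] at h
      exact ⟨P, Q, rfl, hM, h.1.symm, h.2.symm⟩
    | htau A => exact absurd (emits_tau A) hM

theorem isNormalForm_nf (M : Term) : IsNormalForm Clock (nf M) := by
  intro N h
  generalize e : nf M = T at h
  induction h generalizing M with
  | root h =>
    cases h with
    | beta A B =>
      obtain ⟨P, Q, rfl, hM, hA, -⟩ := exists_app_of_nf_eq_app e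
      obtain ⟨P, rfl⟩ := eq_lam_of_nf_eq_lam hA.symm
      exact hM ⟨_, .beta P Q⟩
    | shift A B =>
      obtain ⟨P, Q, rfl, hM, hA, -⟩ := exists_app_of_nf_eq_app e
      obtain ⟨P', hP⟩ := emits_of_nf_eq_tau hA.symm
      exact hM ⟨_, .app Q hP⟩
  | lam h ih =>
    obtain ⟨A, rfl⟩ := eq_lam_of_nf_eq_lam e
    rw [nf_lam, lam_inj] at e
    exact ih A e
  | appL B h ih =>
    obtain ⟨P, Q, rfl, hM, rfl, -⟩ := exists_app_of_nf_eq_app e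
    exact ih P rfl
  | appR B h ih =>
    obtain ⟨P, Q, rfl, hM, -, rfl⟩ := exists_app_of_nf_eq_app e
    exact ih Q rfl
  | tau h ih =>
    obtain ⟨M', hM⟩ := emits_of_nf_eq_tau e
    rw [nf_of_emit hM, tau_inj] at e
    exact ih M' e

/-! ### Simulation of one term by another -/

/-- One layer of the relation `Sim`. The term on the left may emit a `τ` that the term on the right
does not have, provided that `K` holds and at the price of one unit of `n`; it may emit a `τ` that
the term on the right has at its root; or both have the same root symbol. The bound `n` is handed
down along function parts of applications only, so it bounds the number of unmatched emissions
along the left spine. -/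
inductive SimLayer (K : Prop) (X : ℕ → Term → Term → Prop) : ℕ → Term → Term → Prop
  | skip {n : ℕ} {P P' Q : Term} : K → Emit P P' → X n P' Q → SimLayer K X (n + 1) P Q
  | emit {m n : ℕ} {P P' Q : Term} : Emit P P' → X m P' Q → SimLayer K X n P (tau Q)
  | var (n i : ℕ) : SimLayer K X n (var i) (var i)
  | lam {m n : ℕ} {P Q : Term} : X m P Q → SimLayer K X n (lam P) (lam Q)
  | app {m n : ℕ} {P P' Q Q' : Term} :
      X n P P' → X m Q Q' → SimLayer K X n (app P Q) (app P' Q')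

/-- `Sim K n P Q`, coinductively: `P` becomes `Q` by emitting `τ`s, where (if `K` holds) emitted
`τ`s may be dropped, but only finitely many along each left spine, at most `n` of them along the
left spine at the root. Without the bound, a term with an infinite left spine might emit forever
and be related to a term that emits nothing. -/
def Sim (K : Prop) (n : ℕ) (P Q : Term) : Prop :=
  ∃ X : ℕ → Term → Term → Prop, (∀ n P Q, X n P Q → SimLayer K X n P Q) ∧ X n P Q

variable {K : Prop}

theorem SimLayer.mono {X Y : ℕ → Term → Term → Prop} (h : ∀ n P Q, X n P Q → Y n P Q) {n : ℕ}
    {P Q : Term} (l : SimLayer K X n P Q) : SimLayer K Y n P Q := by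
  cases l with
  | skip k e x => exact .skip k e (h _ _ _ x)
  | emit e x => exact .emit e (h _ _ _ x)
  | var n i => exact .var n i
  | lam x => exact .lam (h _ _ _ x)
  | app x y => exact .app (h _ _ _ x) (h _ _ _ y)

theorem Sim.layer {n : ℕ} {P Q : Term} (h : Sim K n P Q) : SimLayer K (Sim K) n P Q := by
  obtain ⟨X, hX, h⟩ := h
  exact (hX n P Q h).mono fun _ _ _ x => ⟨X, hX, x⟩

theorem Sim.coind {X : ℕ → Term → Term → Prop}
    (hX : ∀ n P Q, X n P Q → SimLayer K (fun n P Q => X n P Q ∨ Sim K n P Q) n P Q) {n : ℕ}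
    {P Q : Term} (h : X n P Q) : Sim K n P Q := by
  refine ⟨fun n P Q => X n P Q ∨ Sim K n P Q, fun n P Q h => ?_, .inl h⟩
  obtain h | h := h
  · exact hX n P Q h
  · exact h.layer.mono fun _ _ _ => .inr

theorem SimLayer.sim {n : ℕ} {P Q : Term} (h : SimLayer K (Sim K) n P Q) : Sim K n P Q :=
  Sim.coind (X := SimLayer K (Sim K)) (fun _ _ _ l => l.mono fun _ _ _ => .inr) h

theorem Sim.refl (n : ℕ) (M : Term) : Sim K n M M := by
  refine Sim.coind (X := fun _ P Q => P = Q) ?_ rfl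
  rintro n M _ rfl
  cases M using Term.casesOn with
  | hvar i => exact .var n i
  | hlam A => exact .lam (m := n) (.inl rfl)
  | happ A B => exact .app (m := n) (.inl rfl) (.inl rfl)
  | htau A => exact .emit (m := n) (.tau A) (.inl rfl)

theorem Sim.add_right {n : ℕ} {P Q : Term} (h : Sim K n P Q) (k : ℕ) : Sim K (n + k) P Q := by
  refine Sim.coind (X := fun j P Q => ∃ n, j = n + k ∧ Sim K n P Q) ?_ ⟨n, rfl, h⟩
  rintro _ P Q ⟨n, rfl, h⟩
  replace h := h.layer
  cases h with
  | skip hk e h =>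
    rw [Nat.add_right_comm]
    exact .skip hk e (.inl ⟨_, rfl, h⟩)
  | emit e h => exact .emit e (.inr h)
  | var n i => exact .var _ i
  | lam h => exact .lam (.inr h)
  | app h h' => exact .app (.inl ⟨_, rfl, h⟩) (.inr h')

/-- The bounds are unchanged because the images of the variables are variables. -/
theorem Sim.rename {n : ℕ} {P Q : Term} (h : Sim K n P Q) (ρ : ℕ → ℕ) :
    Sim K n (rename ρ P) (rename ρ Q) := by
  refine Sim.coind
    (X := fun n P Q => ∃ ρ P' Q', Sim K n P' Q' ∧ P = Term.rename ρ P' ∧ Q = Term.rename ρ Q')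
    ?_ ⟨ρ, P, Q, h, rfl, rfl⟩
  rintro n _ _ ⟨ρ, P, Q, h, rfl, rfl⟩
  replace h := h.layer
  cases h with
  | skip hk e h => exact .skip hk (e.rename ρ) (.inl ⟨ρ, _, _, h, rfl, rfl⟩)
  | emit e h =>
    rw [rename_tau]
    exact .emit (e.rename ρ) (.inl ⟨ρ, _, _, h, rfl, rfl⟩)
  | var n i =>
    rw [rename_var]
    exact .var _ _
  | lam h =>
    rw [rename_lam, rename_lam]
    exact .lam (.inl ⟨_, _, _, h, rfl, rfl⟩)
  | app h h' =>
    rw [rename_app, rename_app]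
    exact .app (.inl ⟨_, _, _, h, rfl, rfl⟩) (.inl ⟨_, _, _, h', rfl, rfl⟩)

/-- A left spine of `subst σ P` consists of one of `P`, possibly followed by one of some `σ i`, so
the bounds add up. -/
theorem Sim.subst {n k : ℕ} {P Q : Term} (h : Sim K n P Q) {σ θ : ℕ → Term}
    (hσ : ∀ i, Sim K k (σ i) (θ i)) : Sim K (n + k) (subst σ P) (subst θ Q) := by
  refine Sim.coind
    (X := fun j P Q => ∃ n P' Q' σ θ, j = n + k ∧ Sim K n P' Q' ∧ (∀ i, Sim K k (σ i) (θ i)) ∧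
      P = Term.subst σ P' ∧ Q = Term.subst θ Q')
    ?_ ⟨n, P, Q, σ, θ, rfl, h, hσ, rfl, rfl⟩
  rintro _ _ _ ⟨n, P, Q, σ, θ, rfl, h, hσ, rfl, rfl⟩
  replace h := h.layer
  cases h with
  | skip hk e h =>
    rw [Nat.add_right_comm]
    exact .skip hk (e.subst σ) (.inl ⟨_, _, _, σ, θ, rfl, h, hσ, rfl, rfl⟩)
  | emit e h =>
    rw [subst_tau]
    exact .emit (e.subst σ) (.inl ⟨_, _, _, σ, θ, rfl, h, hσ, rfl, rfl⟩)
  | var n i =>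
    rw [subst_var, subst_var, Nat.add_comm]
    exact ((hσ i).add_right n).layer.mono fun _ _ _ => .inr
  | lam h =>
    rw [subst_lam, subst_lam]
    refine .lam (.inl ⟨_, _, _, _, _, rfl, h, fun i => ?_, rfl, rfl⟩)
    cases i with
    | zero => exact .refl k _
    | succ i => exact (hσ i).rename _
  | app h h' =>
    rw [subst_app, subst_app]
    exact .app (.inl ⟨_, _, _, σ, θ, rfl, h, hσ, rfl, rfl⟩)
      (.inl ⟨_, _, _, σ, θ, rfl, h', hσ, rfl, rfl⟩)

theorem Sim.inst {n k : ℕ} {P P' Q Q' : Term} (h : Sim K n P P') (h' : Sim K k Q Q') :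
    Sim K (n + k) (inst P Q) (inst P' Q') := by
  refine h.subst fun i => ?_
  cases i with
  | zero => exact h'
  | succ i => exact .refl k _

/-- A root step inside a term is simulated as soon as it is simulated at the root. -/
theorem Sim.of_step {R : Term → Term → Prop} {n : ℕ} (hR : ∀ P Q, R P Q → Sim K n P Q)
    {M N : Term} (h : Step R M N) : Sim K n M N := by
  induction h with
  | root h => exact hR _ _ h
  | lam _ ih => exact (SimLayer.lam ih).sim
  | appL P _ ih => exact (SimLayer.app ih (.refl n P)).sim
  | appR P _ ih => exact (SimLayer.app (.refl n P) ih).sim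
  | tau _ ih => exact (SimLayer.emit (.tau _) ih).sim

theorem Sim.of_step_clock {M N : Term} (h : Step Clock M N) : Sim False 0 M N := by
  refine Sim.of_step (fun P Q h => ?_) h
  cases h with
  | beta A B => exact (SimLayer.emit (.beta A B) (.refl 0 _)).sim
  | shift A B => exact (SimLayer.emit (.app B (.tau A)) (.refl 0 _)).sim

theorem Sim.of_step_beta {M N : Term} (h : Step Beta M N) : Sim True 1 M N := by
  refine Sim.of_step (fun P Q h => ?_) h
  cases h with
  | beta A B => exact (SimLayer.skip trivial (.beta A B) (.refl 0 _)).sim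

/-! ### Simulation and emission -/

/-- Emissions that drop the emitted `τ`s; only available if `K` holds. -/
def Skip (K : Prop) : Term → Term → Prop := Relation.ReflTransGen fun P Q => K ∧ Emit P Q

theorem Skip.app {P P' : Term} (h : Skip K P P') (Q : Term) : Skip K (app P Q) (app P' Q) :=
  Relation.ReflTransGen.lift (p := fun P Q => K ∧ Emit P Q) (fun P => Term.app P Q)
    (fun _ _ h => ⟨h.1, .app Q h.2⟩) _ _ h

/-- All unmatched emissions at the root can be carried out first. -/
theorem Sim.exists_skip {n : ℕ} {P Q : Term} (h : Sim K n P Q) :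
    ∃ m P', Skip K P P' ∧ SimLayer False (Sim K) m P' Q := by
  induction n generalizing P with
  | zero =>
    refine ⟨0, P, .refl, ?_⟩
    generalize hn : 0 = n at h
    replace h := h.layer
    cases h with
    | skip hk e h => simp at hn
    | emit e h => exact .emit e h
    | var n i => exact .var _ i
    | lam h => exact .lam h
    | app h h' => exact .app (hn ▸ h) h'
  | succ n ih =>
    replace h := h.layer
    cases h with
    | skip hk e h =>
      obtain ⟨m, P', s, l⟩ := ih h
      exact ⟨m, P', .head ⟨hk, e⟩ s, l⟩
    | emit e h => exact ⟨0, P, .refl, .emit e h⟩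
    | var _ i => exact ⟨0, _, .refl, .var _ i⟩
    | lam h => exact ⟨0, _, .refl, .lam h⟩
    | app h h' => exact ⟨n + 1, _, .refl, .app h h'⟩

theorem SimLayer.lam_inv {X : ℕ → Term → Term → Prop} {n : ℕ} {P B : Term}
    (h : SimLayer False X n P (Term.lam B)) : ∃ m A, P = Term.lam A ∧ X m A B := by
  generalize e : Term.lam B = Q at h
  cases h with
  | skip k => exact k.elim
  | lam h => exact ⟨_, _, rfl, lam_inj.1 e ▸ h⟩
  | _ => simp at e

theorem SimLayer.tau_inv {X : ℕ → Term → Term → Prop} {n : ℕ} {P B : Term}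
    (h : SimLayer False X n P (tau B)) : ∃ m A, Emit P A ∧ X m A B := by
  generalize e : Term.tau B = Q at h
  cases h with
  | skip k => exact k.elim
  | emit h x => exact ⟨_, _, h, tau_inj.1 e ▸ x⟩
  | _ => simp at e

theorem SimLayer.app_inv {X : ℕ → Term → Term → Prop} {n : ℕ} {P B B' : Term}
    (h : SimLayer False X n P (Term.app B B')) :
    ∃ m A A', P = Term.app A A' ∧ X n A B ∧ X m A' B' := by
  generalize e : Term.app B B' = Q at h
  cases h with
  | skip k => exact k.elim
  | app h h' =>
    obtain ⟨rfl, rfl⟩ := app_inj.1 e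
    exact ⟨_, _, _, rfl, h, h'⟩
  | _ => simp at e

/-- Every emission on the right is matched on the left, after finitely many unmatched ones. -/
theorem Sim.exists_emit {n : ℕ} {M N N' : Term} (h : Sim K n M N) (e : Emit N N') :
    ∃ m M₀ M', Skip K M M₀ ∧ Emit M₀ M' ∧ Sim K m M' N' := by
  obtain ⟨j, M₀, s, l⟩ := h.exists_skip
  induction e generalizing n j M M₀ with
  | tau N =>
    obtain ⟨m, M', e, h⟩ := l.tau_inv
    exact ⟨m, M₀, M', s, e, h⟩
  | beta A B =>
    obtain ⟨m, P, Q, rfl, hP, hQ⟩ := l.app_inv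
    obtain ⟨i, P₀, sP, lP⟩ := hP.exists_skip
    obtain ⟨k, A', rfl, hA⟩ := lP.lam_inv
    exact ⟨_, _, _, s.trans (sP.app Q), .beta A' Q, hA.inst hQ⟩
  | app B _ ih =>
    obtain ⟨m, P, Q, rfl, hP, hQ⟩ := l.app_inv
    obtain ⟨i, P₀, sP, lP⟩ := hP.exists_skip
    obtain ⟨k, P₁, P', sP', e, h⟩ := ih hP _ _ sP lP
    exact ⟨_, _, _, s.trans (sP'.app Q), .app Q e, (SimLayer.app h hQ).sim⟩

/-- If the term on the right emits nothing, then each emission on the left is unmatched and uses up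
some of the bound. -/
theorem Sim.emit_of_not_emits {n : ℕ} {M M' N : Term} (h : Sim K n M N) (e : Emit M M')
    (hN : ¬ Emits N) : K ∧ ∃ m < n, Sim K m M' N := by
  induction e generalizing n N with
  | tau M =>
    generalize eM : Term.tau M = P at h
    replace h := h.layer
    cases h with
    | skip hk e h =>
      subst eM
      exact ⟨hk, _, Nat.lt_succ_self _, emit_tau_iff.1 e ▸ h⟩
    | emit e h => exact absurd (emits_tau _) hN
    | _ => simp at eM
  | beta A B =>
    generalize eM : Term.app (Term.lam A) B = P at h
    replace h := h.layer
    cases h with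
    | skip hk e h =>
      subst eM
      exact ⟨hk, _, Nat.lt_succ_self _, (Emit.beta A B).unique e ▸ h⟩
    | emit e h => exact absurd (emits_tau _) hN
    | app h h' =>
      obtain ⟨rfl, rfl⟩ := app_inj.1 eM
      generalize eA : Term.lam A = P at h
      replace h := h.layer
      cases h with
      | skip hk e h => exact absurd e (eA ▸ not_emit_lam)
      | emit e h => exact absurd e (eA ▸ not_emit_lam)
      | lam h => exact absurd ⟨_, .beta _ _⟩ hN
      | _ => simp at eA
    | _ => simp at eM
  | @app A A' B e ih =>
    generalize eM : Term.app A B = P at h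
    replace h := h.layer
    cases h with
    | skip hk e' h =>
      subst eM
      exact ⟨hk, _, Nat.lt_succ_self _, (Emit.app B e).unique e' ▸ h⟩
    | emit e h => exact absurd (emits_tau _) hN
    | app h h' =>
      obtain ⟨rfl, rfl⟩ := app_inj.1 eM
      obtain ⟨hk, m, hm, h⟩ := ih h fun ⟨_, e⟩ => hN ⟨_, .app _ e⟩
      exact ⟨hk, m, hm, (SimLayer.app h h').sim⟩
    | _ => simp at eM

theorem Sim.exists_skip_not_emits {n : ℕ} {M N : Term} (h : Sim K n M N) (hN : ¬ Emits N) :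
    ∃ m M', Skip K M M' ∧ ¬ Emits M' ∧ Sim K m M' N := by
  induction n using Nat.strong_induction_on generalizing M with
  | _ n ih =>
    by_cases hM : Emits M
    · obtain ⟨M', e⟩ := hM
      obtain ⟨hk, m, hm, h⟩ := h.emit_of_not_emits e hN
      obtain ⟨j, M'', s, r⟩ := ih m hm h
      exact ⟨j, M'', .head ⟨hk, e⟩ s, r⟩
    · exact ⟨n, M, .refl, hM, h⟩

/-- Simulation of terms is inherited by their normal forms: after the unmatched `τ`s have been
skipped, the normal forms have the same root symbol. -/
theorem Sim.exists_skip_below_nf {n : ℕ} {M N : Term} (h : Sim K n M N) :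
    ∃ M₀, Skip K M M₀ ∧
      Below (fun S T => ∃ n P Q, Sim K n P Q ∧ S = nf P ∧ T = nf Q) (nf M₀) (nf N) := by
  by_cases hN : Emits N
  · obtain ⟨N', hN⟩ := hN
    obtain ⟨m, M₀, M', s, e, h⟩ := h.exists_emit hN
    refine ⟨M₀, s, ?_⟩
    rw [nf_of_emit e, nf_of_emit hN]
    exact .tau ⟨m, M', N', h, rfl, rfl⟩
  · obtain ⟨m, M₀, s, hM, l⟩ := h.exists_skip_not_emits hN
    refine ⟨M₀, s, ?_⟩
    replace l := l.layer
    cases l with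
    | skip hk e h => exact absurd ⟨_, e⟩ hM
    | emit e h => exact absurd ⟨_, e⟩ hM
    | var n i =>
      rw [nf_var]
      exact .var i
    | lam l =>
      rw [nf_lam, nf_lam]
      exact .lam ⟨_, _, _, l, rfl, rfl⟩
    | app l l' =>
      rw [nf_app hM, nf_app hN]
      exact .app ⟨_, _, _, l, rfl, rfl⟩ ⟨_, _, _, l', rfl, rfl⟩

theorem Sim.nf_eq {n : ℕ} {M N : Term} (h : Sim False n M N) : nf M = nf N := by
  refine eq_of_below (X := fun S T => ∃ n P Q, Sim False n P Q ∧ S = nf P ∧ T = nf Q) ?_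
    ⟨n, M, N, h, rfl, rfl⟩
  rintro _ _ ⟨n, P, Q, h, rfl, rfl⟩
  obtain ⟨M₀, s, b⟩ := h.exists_skip_below_nf
  obtain rfl | ⟨_, ⟨k, -⟩, -⟩ := s.cases_head
  exacts [b, k.elim]

theorem Skip.red_nf {M N : Term} (h : Skip K M N) : Red Delete (nf M) (nf N) := by
  induction h with
  | refl => exact .refl
  | tail _ h ih =>
    rw [nf_of_emit h.2] at ih
    exact ih.tail (.root (.delete _))

theorem Sim.infRed_nf {n : ℕ} {M N : Term} (h : Sim K n M N) : InfRed Delete (nf M) (nf N) := by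
  refine ⟨fun S T => ∃ n P Q, Sim K n P Q ∧ S = nf P ∧ T = nf Q, ?_, ⟨n, M, N, h, rfl, rfl⟩⟩
  rintro _ _ ⟨n, P, Q, h, rfl, rfl⟩
  obtain ⟨M₀, s, b⟩ := h.exists_skip_below_nf
  exact ⟨_, s.red_nf, b⟩

/-! ### Uniqueness of infinitary normal forms -/

theorem nf_eq_of_red {M N : Term} (h : Red Clock M N) : nf M = nf N := by
  induction h with
  | refl => rfl
  | tail _ h ih => exact ih.trans (Sim.of_step_clock h).nf_eq

theorem InfRed.exists_below {R : Term → Term → Prop} {M N : Term} (h : InfRed R M N) :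
    ∃ P, Red R M P ∧ Below (InfRed R) P N := by
  obtain ⟨X, hX, h⟩ := h
  obtain ⟨P, r, b⟩ := hX M N h
  exact ⟨P, r, b.mono fun _ _ x => ⟨X, hX, x⟩⟩

theorem InfRed.of_red_below {R : Term → Term → Prop} {M P N : Term} (r : Red R M P)
    (b : Below (InfRed R) P N) : InfRed R M N := by
  refine ⟨fun M N => ∃ P, Red R M P ∧ Below (InfRed R) P N, ?_, ⟨P, r, b⟩⟩
  rintro M N ⟨P, r, b⟩
  exact ⟨P, r, b.mono fun _ _ h => h.exists_below⟩

theorem InfRed.head {R : Term → Term → Prop} {M P N : Term} (h : InfRed R P N)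
    (r : Red R M P) : InfRed R M N := by
  obtain ⟨Q, r', b⟩ := h.exists_below
  exact .of_red_below (r.trans r') b

/-- The left spine of the term is finite and ends in an abstraction or a `τ`. -/
inductive Active : Term → Prop
  | lam (M : Term) : Active (lam M)
  | tau (M : Term) : Active (tau M)
  | app {M : Term} (N : Term) : Active M → Active (app M N)

theorem active_app {M N : Term} : Active (app M N) ↔ Active M := by
  refine ⟨fun h => ?_, .app N⟩
  generalize e : Term.app M N = P at h
  cases h with
  | app N h => exact (app_inj.1 e).1 ▸ h
  | _ => simp at e

theorem Emit.active {M M' : Term} (h : Emit M M') : Active M := by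
  induction h with
  | tau M => exact .tau M
  | beta M N => exact .app N (.lam M)
  | app N _ ih => exact .app N ih

theorem Step.clock_app_inv {M N P : Term} (h : Step Clock (Term.app M N) P) :
    (∃ A, P = Term.tau A) ∨ ∃ M' N', P = Term.app M' N' ∧ Red Clock M M' := by
  generalize e : Term.app M N = Q at h
  cases h with
  | root h => cases h <;> exact .inl ⟨_, rfl⟩
  | appL B h => exact .inr ⟨_, _, rfl, .single ((app_inj.1 e).1 ▸ h)⟩
  | appR A h => exact .inr ⟨_, _, rfl, (app_inj.1 e).1 ▸ .refl⟩
  | _ => simp at e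

theorem Step.clock_tau_inv {M P : Term} (h : Step Clock (Term.tau M) P) :
    ∃ A, P = Term.tau A := by
  generalize e : Term.tau M = Q at h
  cases h with
  | root h => cases h <;> simp at e
  | tau h => exact ⟨_, rfl⟩
  | _ => simp at e

theorem Step.clock_lam_inv {M P : Term} (h : Step Clock (Term.lam M) P) :
    ∃ A, P = Term.lam A := by
  generalize e : Term.lam M = Q at h
  cases h with
  | root h => cases h <;> simp at e
  | lam h => exact ⟨_, rfl⟩
  | _ => simp at e

theorem red_clock_app_inv {M N P : Term} (h : Red Clock (app M N) P) :
    (∃ A, P = tau A) ∨ ∃ M' N', P = app M' N' ∧ Red Clock M M' := by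
  induction h with
  | refl => exact .inr ⟨_, _, rfl, .refl⟩
  | tail _ h ih =>
    obtain ⟨A, rfl⟩ | ⟨M', N', rfl, r⟩ := ih
    · exact .inl h.clock_tau_inv
    · obtain h | ⟨M'', N'', rfl, r'⟩ := h.clock_app_inv
      exacts [.inl h, .inr ⟨_, _, rfl, r.trans r'⟩]

/-- Steps on the left spine only ever put a `τ` there, so an active spine stays active. As it is
finite, this persists in the limit, by induction on its length. -/
theorem InfRed.active {M T : Term} (h : InfRed Clock M T) (hM : Active M) : Active T := by
  obtain ⟨P, r, b⟩ := h.exists_below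
  induction hM generalizing P T with
  | lam M =>
    have : ∃ A, P = lam A := by
      clear b h
      induction r with
      | refl => exact ⟨M, rfl⟩
      | tail _ h ih =>
        obtain ⟨A, rfl⟩ := ih
        exact h.clock_lam_inv
    obtain ⟨A, rfl⟩ := this
    generalize e : Term.lam A = Q at b
    cases b with
    | lam => exact .lam _
    | _ => simp at e
  | tau M =>
    have : ∃ A, P = tau A := by
      clear b h
      induction r with
      | refl => exact ⟨M, rfl⟩
      | tail _ h ih =>
        obtain ⟨A, rfl⟩ := ih
        exact h.clock_tau_inv
    obtain ⟨A, rfl⟩ := this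
    generalize e : Term.tau A = Q at b
    cases b with
    | tau => exact .tau _
    | _ => simp at e
  | app N hM ih =>
    obtain ⟨A, rfl⟩ | ⟨M', N', rfl, r'⟩ := red_clock_app_inv r
    · generalize e : Term.tau A = Q at b
      cases b with
      | tau => exact .tau _
      | _ => simp at e
    · generalize e : Term.app M' N' = Q at b
      cases b with
      | app a a' =>
        obtain ⟨rfl, rfl⟩ := app_inj.1 e
        obtain ⟨P, r, b⟩ := a.exists_below
        exact .app _ (ih (a.head r') P (r'.trans r) b)
      | _ => simp at e

/-- An application in normal form has an infinite left spine or one that ends in a variable. -/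
theorem Active.not_isNormalForm_app {M : Term} (h : Active M) (N : Term) :
    ¬ IsNormalForm Clock (Term.app M N) := by
  suffices ∃ P, Step Clock (Term.app M N) P from fun hn => hn _ this.choose_spec
  induction h generalizing N with
  | lam M => exact ⟨_, .root (.beta M N)⟩
  | tau M => exact ⟨_, .root (.shift M N)⟩
  | app B _ ih => exact ⟨_, .appL N (ih B).choose_spec⟩

theorem HasInfNormalForm.eq_nf {M T : Term} (h : HasInfNormalForm M T) : T = nf M := by
  refine (eq_of_below (X := fun S T => ∃ M, S = nf M ∧ HasInfNormalForm M T) ?_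
    ⟨M, rfl, h⟩).symm
  rintro _ T ⟨M, rfl, h, hT⟩
  obtain ⟨P, r, b⟩ := h.exists_below
  rw [nf_eq_of_red r]
  cases b with
  | var n =>
    rw [nf_var]
    exact .var n
  | lam a =>
    rw [nf_lam]
    exact .lam ⟨_, rfl, a, fun N s => hT _ (.lam s)⟩
  | @app A A' B B' a a' =>
    have hP : ¬ Emits (Term.app A B) := fun ⟨_, e⟩ =>
      (a.active (active_app.1 e.active)).not_isNormalForm_app B' hT
    rw [nf_app hP]
    exact .app ⟨_, rfl, a, fun N s => hT _ (.appL _ s)⟩ ⟨_, rfl, a', fun N s => hT _ (.appR _ s)⟩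
  | tau a =>
    rw [nf_of_emit (.tau _)]
    exact .tau ⟨_, rfl, a, fun N s => hT _ (.tau s)⟩

theorem isClockedLevyTree_nf (M : Term) : IsClockedLevyTree M (nf M) :=
  ⟨⟨infRed_nf M, isNormalForm_nf M⟩, fun _ h => h.eq_nf⟩

/-! ### Infinitary deletion is transitive -/

theorem Below.var_inv {X : Term → Term → Prop} {M : Term} {n : ℕ} (b : Below X M (Term.var n)) :
    M = Term.var n := by
  generalize e : Term.var n = T at b
  cases b with
  | var m => rfl
  | _ => simp at e

theorem Below.lam_inv {X : Term → Term → Prop} {M N : Term} (b : Below X M (Term.lam N)) :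
    ∃ A, M = Term.lam A ∧ X A N := by
  generalize e : Term.lam N = T at b
  cases b with
  | lam a => exact ⟨_, rfl, lam_inj.1 e ▸ a⟩
  | _ => simp at e

theorem Below.app_inv {X : Term → Term → Prop} {M N N' : Term} (b : Below X M (Term.app N N')) :
    ∃ A A', M = Term.app A A' ∧ X A N ∧ X A' N' := by
  generalize e : Term.app N N' = T at b
  cases b with
  | app a a' => exact ⟨_, _, rfl, (app_inj.1 e).1 ▸ a, (app_inj.1 e).2 ▸ a'⟩
  | _ => simp at e

theorem Below.tau_inv {X : Term → Term → Prop} {M N : Term} (b : Below X M (Term.tau N)) :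
    ∃ A, M = Term.tau A ∧ X A N := by
  generalize e : Term.tau N = T at b
  cases b with
  | tau a => exact ⟨_, rfl, tau_inj.1 e ▸ a⟩
  | _ => simp at e

theorem InfRed.refl {R : Term → Term → Prop} (M : Term) : InfRed R M M :=
  ⟨Eq, fun P _ h => h ▸ ⟨P, .refl, Below.refl (fun _ => rfl) P⟩, rfl⟩

/-- A single deletion after an infinitary one is absorbed: a `τ` in the limit stems from a `τ` that
is reached after finitely many steps and can be deleted there. -/
theorem InfRed.step_delete {M P Q : Term} (h : InfRed Delete M P) (s : Step Delete P Q) :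
    InfRed Delete M Q := by
  obtain ⟨M', r, b⟩ := h.exists_below
  induction s generalizing M M' with
  | root s =>
    cases s
    obtain ⟨A, rfl, a⟩ := b.tau_inv
    exact a.head (r.tail (.root (.delete _)))
  | lam _ ih =>
    obtain ⟨A, rfl, a⟩ := b.lam_inv
    obtain ⟨N, r', b'⟩ := a.exists_below
    exact .of_red_below r (.lam (ih a _ r' b'))
  | appL _ _ ih =>
    obtain ⟨A, B, rfl, a, a'⟩ := b.app_inv
    obtain ⟨N, r', b'⟩ := a.exists_below
    exact .of_red_below r (.app (ih a _ r' b') a')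
  | appR _ _ ih =>
    obtain ⟨A, B, rfl, a, a'⟩ := b.app_inv
    obtain ⟨N, r', b'⟩ := a'.exists_below
    exact .of_red_below r (.app a (ih a' _ r' b'))
  | tau _ ih =>
    obtain ⟨A, rfl, a⟩ := b.tau_inv
    obtain ⟨N, r', b'⟩ := a.exists_below
    exact .of_red_below r (.tau (ih a _ r' b'))

theorem InfRed.red_delete {M P Q : Term} (h : InfRed Delete M P) (r : Red Delete P Q) :
    InfRed Delete M Q := by
  induction r with
  | refl => exact h
  | tail _ s ih => exact ih.step_delete s

theorem InfRed.trans_delete {M P Q : Term} (h : InfRed Delete M P) (h' : InfRed Delete P Q) :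
    InfRed Delete M Q := by
  refine ⟨fun M Q => ∃ P, InfRed Delete M P ∧ InfRed Delete P Q, ?_, ⟨P, h, h'⟩⟩
  rintro M Q ⟨P, h, h'⟩
  obtain ⟨P', r, b⟩ := h'.exists_below
  obtain ⟨M', r', b'⟩ := (h.red_delete r).exists_below
  refine ⟨M', r', ?_⟩
  cases b with
  | var n =>
    obtain rfl := b'.var_inv
    exact .var n
  | lam a =>
    obtain ⟨A, rfl, c⟩ := b'.lam_inv
    exact .lam ⟨_, c, a⟩
  | app a a' =>
    obtain ⟨A, B, rfl, c, c'⟩ := b'.app_inv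
    exact .app ⟨_, c, a⟩ ⟨_, c', a'⟩
  | tau a =>
    obtain ⟨A, rfl, c⟩ := b'.tau_inv
    exact .tau ⟨_, c, a⟩

theorem infRed_nf_of_red_beta {M N : Term} (h : Red Beta M N) : InfRed Delete (nf M) (nf N) := by
  induction h with
  | refl => exact .refl _
  | tail _ s ih => exact ih.trans_delete (Sim.of_step_beta s).infRed_nf

end ClockedLambda

theorem mainTheorem2 (M N : ClockedLambda.Term)
    (hMN : ClockedLambda.Red ClockedLambda.Beta M N) :
    ClockedLambda.GloballyImprovedBy M N :=
  ⟨ClockedLambda.nf M, ClockedLambda.nf N, ClockedLambda.isClockedLevyTree_nf M,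
    ClockedLambda.isClockedLevyTree_nf N, ClockedLambda.infRed_nf_of_red_beta hMN⟩
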